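/- For a finite abelian group $F$ and configurations $\sigma\in G_F:=\{-1,1\}^F$, let $H(\sigma,j)=\sum_{f\in F} j_f\sum_{\ell\in F}\sigma_\ell\,\sigma_{\ell+f}$ $(j\in\mathbb{R}^F)$ be the energy of $\sigma$ under the interaction $j$, and let the stable degeneracy of $\sigma$ be \[D_{\rm stab}(\sigma):=\big|\{\tau\in G_F\mid H(\tau,j)=H(\sigma,j)\text{ for all }j\in\mathbb{R}^F\}\big|.\] Let $p$ be a prime, $n\ge 1$, $q=p^n$ and $N=q^2+q+1$. Regard $\mathbb{F}_{q^3}$ as a three-dimensional vector space over $\mathbb{F}_q$ and let ${\rm PG}(2,q)$ be its projective plane, whose points and lines are the one- and two-dimensional $\mathbb{F}_q$-subspaces. Let $\Sigma$ be the Singer group, that is, the cyclic group of order $N$ of the automorphisms of ${\rm PG}(2,q)$ induced by multiplication with the elements of $\mathbb{F}_{q^3}^\times$, identified with $\mathbb{Z}/N\mathbb{Z}$ through an arbitrary generator. For a point $A$ and a line $L$ of ${\rm PG}(2,q)$ let \[\mathcal{D}=\mathcal{D}(A,L):=\{g\in\Sigma\mid g(A)\in L\}\subseteq\mathbb{Z}/N\mathbb{Z}.\]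 **Proposition.** For all $A$ and $L$, the set $\mathcal{D}$ is a perfect difference set (every nonzero $h\in\mathbb{Z}/N\mathbb{Z}$ is $d_2-d_1$ for a unique pair $(d_1,d_2)\in\mathcal{D}\times\mathcal{D}$), and the configuration $(-1)^{\mathbf{1}_{\mathcal{D}}}\in\{-1,1\}^{\mathbb{Z}/N\mathbb{Z}}$, which is $-1$ on $\mathcal{D}$ and $1$ off $\mathcal{D}$, satisfies \[D_{\rm stab}\big((-1)^{\mathbf{1}_{\mathcal{D}}}\big)\ \ge\ \frac{2N\varphi(N)}{3n},\] where $\varphi$ is Euler's totient function. -/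

import Mathlib

open scoped LinearAlgebra.Projectivization

namespace Ising

/-- The configuration space `G_F = {-1, 1}^F`. -/
abbrev Config (F : Type*) := F → ℤˣ

/-- The energy `H_F(σ, j) = ∑_f j_f ∑_ℓ σ_ℓ σ_{ℓ+f}` of the translation invariant Ising model. -/
def energy {F : Type*} [AddCommGroup F] [Fintype F] (σ : Config F) (j : F → ℝ) : ℝ :=
  ∑ f : F, j f * ∑ l : F, (((σ l : ℤ) : ℝ) * ((σ (l + f) : ℤ) : ℝ))

/-- The stable degeneracy of `σ`: the number of configurations that have the same energy
as `σ` for every interaction `j`. -/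
noncomputable def stableDegeneracy {F : Type*} [AddCommGroup F] [Fintype F]
    (σ : Config F) : ℕ :=
  Nat.card {τ : Config F // ∀ j : F → ℝ, energy τ j = energy σ j}

/-- The correlation map `A_F(σ)_f = ∑_ℓ σ_ℓ σ_{ℓ+f}`. -/
def correlation {F : Type*} [AddCommGroup F] [Fintype F] (σ : Config F) (f : F) : ℤ :=
  ∑ l : F, (σ l : ℤ) * (σ (l + f) : ℤ)

theorem energy_eq_sum_correlation {F : Type*} [AddCommGroup F] [Fintype F]
    (σ : Config F) (j : F → ℝ) : energy σ j = ∑ f : F, j f * (correlation σ f : ℝ) := by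
  simp [energy, correlation]

/-- The stable degeneracy of `σ` is the cardinality of the fibre of the correlation map
through `σ`. -/
theorem stableDegeneracy_eq_card_fibre {F : Type*} [AddCommGroup F] [Fintype F]
    (σ : Config F) :
    stableDegeneracy σ = Nat.card {τ : Config F // correlation τ = correlation σ} := by
  classical
  refine Nat.card_congr (Equiv.subtypeEquivRight fun τ => ⟨fun h => ?_, fun h j => ?_⟩)
  · funext f
    have h1 := h (Pi.single f 1)
    simpa [energy_eq_sum_correlation, Pi.single_apply] using h1
  · rw [energy_eq_sum_correlation, energy_eq_sum_correlation, h]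

/-- The configuration `(-1)^{1_D}` attributed to a subset `D` of `F`:
it is `-1` on `D` and `1` off `D`. -/
noncomputable def configOf {F : Type*} (D : Set F) : Config F :=
  fun f => (-1) ^ D.indicator (fun _ => (1 : ℕ)) f

/-- `D` is perfect: every nonzero `h` is `d₂ - d₁` for a unique pair `(d₁, d₂)` in `D × D`. -/
def IsPerfectDifferenceSet {F : Type*} [AddCommGroup F] (D : Set F) : Prop :=
  ∀ h : F, h ≠ 0 → ∃! d : F × F, d.1 ∈ D ∧ d.2 ∈ D ∧ h = d.2 - d.1

/-- The Singer group: the group of those permutations of the points of the projective space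
`ℙ K E` that are induced by multiplication with the nonzero elements of `E`. For `K` with
`q` elements and `E` the cubic extension of `K`, regarded as a three-dimensional vector space
over `K`, the space `ℙ K E` is the Desarguesian plane `PG(2, q)`. -/
noncomputable def singerGroup (K E : Type*) [Field K] [Field E] [Algebra K E] :
    Subgroup (Equiv.Perm (ℙ K E)) :=
  (MulAction.toPermHom Eˣ (ℙ K E)).range

/-- The difference set `{g ∈ Σ | g(A) ∈ L}` of a point `A` and a line `L`, where a line
is given by a subspace and consists of the points contained in that subspace. -/
def differenceSet {K E : Type*} [Field K] [Field E] [Algebra K E]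
    (A : ℙ K E) (L : Submodule K E) : Set (singerGroup K E) :=
  {g | (g.1 A).submodule ≤ L}

/-- The subset of `ℤ/Nℤ` that corresponds to the difference set of `A` and `L`, when
the Singer group is identified with `ℤ/Nℤ` through a generator `g` of it
(`k = 0, …, N - 1` corresponds to `g ^ k`). -/
def cyclicDifferenceSet {K E : Type*} [Field K] [Field E] [Algebra K E]
    (N : ℕ) (g : singerGroup K E) (A : ℙ K E) (L : Submodule K E) : Set (ZMod N) :=
  {k | g ^ k.val ∈ differenceSet A L}

end Ising

/-! A perfect difference set has a correlation that is constant away from `0`, so each of the `2 *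
φ(N) * N` substitutions `l ↦ s * σ (c * l + b)` stays in the fibre of the correlation map. It
remains to bound how often two substitutions agree. The sign is fixed because `N` is odd, and for
given `c` the shift is fixed because `D` has no period. The values of `c` in one fibre form, up to a
common factor, a set of multipliers: units `a` for which some map `l ↦ a * l + b` preserves `D`.

There are at most `3 * n` multipliers. A discrete logarithm identifies points of the plane with
`ZMod N` and `D` with a line, and all lines are multiples of that line. Hence multiplication by a
multiplier is a collineation, multiplicative on points. By the fundamental theorem it is induced by
a semilinear map (`IsCollineation.exists_semilinear`), and multiplicativity makes this map a field
endomorphism up to a scalar (`IsCollineation.exists_ringHom`). A field with `p ^ (3 * n)` elements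
has at most `3 * n` endomorphisms. -/

/-- The coordinates of a vector with respect to three independent vectors are unique. -/
theorem LinearIndependent.coeff_eq_of_three {K V : Type*} [Field K] [AddCommGroup V] [Module K V]
    {v : Fin 3 → V} (hv : LinearIndependent K v) {a b c a' b' c' : K}
    (h : a • v 0 + b • v 1 + c • v 2 = a' • v 0 + b' • v 1 + c' • v 2) :
    a = a' ∧ b = b' ∧ c = c' := by
  have h0 := Fintype.linearIndependent_iff.1 hv ![a - a', b - b', c - c'] (by
    simp only [Fin.sum_univ_three, Matrix.cons_val_zero, Matrix.cons_val_one, Matrix.cons_val]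
    linear_combination (norm := module) h)
  exact ⟨sub_eq_zero.1 (h0 0), sub_eq_zero.1 (h0 1), sub_eq_zero.1 (h0 2)⟩

/-! ### Collineations and the fundamental theorem of projective geometry -/

/-- A correspondence between the nonzero vectors of two vector spaces that induces a map of
projective points preserving and reflecting collinearity. -/
structure IsCollineation (K : Type*) {V W : Type*} [Field K] [AddCommGroup V] [Module K V]
    [AddCommGroup W] [Module K W] (R : V → W → Prop) : Prop where
  left_ne_zero : ∀ {x y}, R x y → x ≠ 0
  right_ne_zero : ∀ {x y}, R x y → y ≠ 0
  exists_right : ∀ {x}, x ≠ 0 → ∃ y, R x y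
  smul : ∀ {x y} {c d : K}, R x y → c ≠ 0 → d ≠ 0 → R (c • x) (d • y)
  mem_span_iff : ∀ {x y z x' y' z'}, R x x' → R y y' → R z z' →
    (z' ∈ Submodule.span K {x', y'} ↔ z ∈ Submodule.span K {x, y})

namespace IsCollineation

variable {K V W : Type*} [Field K] [AddCommGroup V] [Module K V]
    [AddCommGroup W] [Module K W] {R : V → W → Prop}

/-- The image of `x + t • y` lies on the line of `x'` and `y'` but differs from the point `y'`, so
its `x'`-coefficient can be scaled to `1`. -/
theorem exists_add_smul (hR : IsCollineation K R) {x y : V} {x' y' : W} (hx : R x x')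
    (hy : R y y') (hxy : LinearIndependent K ![x, y]) (t : K) :
    ∃ s : K, R (x + t • y) (x' + s • y') := by
  have hi := LinearIndependent.pair_iff.1 hxy
  have hne : x + t • y ≠ 0 := fun h => one_ne_zero (hi 1 t (by rwa [one_smul])).1
  obtain ⟨z, hz⟩ := hR.exists_right hne
  obtain ⟨a, b, hab⟩ := Submodule.mem_span_pair.1 ((hR.mem_span_iff hx hy hz).2
    (Submodule.mem_span_pair.2 ⟨1, t, by rw [one_smul]⟩))
  have ha : a ≠ 0 := by
    rintro rfl
    obtain ⟨c, d, hcd⟩ := Submodule.mem_span_pair.1 ((hR.mem_span_iff hy hy hz).1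
      (Submodule.mem_span_pair.2 ⟨b, 0, by rw [← hab]; simp⟩))
    exact one_ne_zero (hi 1 (t - c - d) (by linear_combination (norm := module) -hcd)).1
  refine ⟨a⁻¹ * b, ?_⟩
  have := hR.smul hz one_ne_zero (inv_ne_zero ha)
  rwa [one_smul, ← hab, smul_add, smul_smul, smul_smul, inv_mul_cancel₀ ha, one_smul] at this

/-- With a repeated point, `mem_span_iff` expresses equality of projective points. -/
theorem eq_smul (hR : IsCollineation K R) {x : V} {y z : W} (hy : R x y) (hz : R x z) :
    ∃ c : K, c ≠ 0 ∧ z = c • y := by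
  obtain ⟨c, d, hcd⟩ := Submodule.mem_span_pair.1 ((hR.mem_span_iff hy hy hz).2
    (Submodule.mem_span_pair.2 ⟨1, 0, by simp⟩))
  have h : z = (c + d) • y := by rw [← hcd, add_smul]
  refine ⟨c + d, fun h0 => hR.right_ne_zero hz ?_, h⟩
  rw [h, h0, zero_smul]

theorem linearIndependent (hR : IsCollineation K R) {v : Fin 3 → V} {w : Fin 3 → W}
    (hv : LinearIndependent K v) (h : ∀ i, R (v i) (w i)) : LinearIndependent K w := by
  have h01 : w 1 ∉ Submodule.span K {w 0} := fun hm => by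
    rw [← Set.pair_eq_singleton, hR.mem_span_iff (h 0) (h 0) (h 1), Set.pair_eq_singleton] at hm
    obtain ⟨c, hc⟩ := Submodule.mem_span_singleton.1 hm
    have := hv.coeff_eq_of_three (a := c) (b := 0) (c := 0) (a' := 0) (b' := 1) (c' := 0)
      (by simpa using hc)
    exact zero_ne_one this.2.1
  have h2 : w 2 ∉ Submodule.span K {w 0, w 1} := fun hm => by
    rw [hR.mem_span_iff (h 0) (h 1) (h 2)] at hm
    obtain ⟨c, d, hc⟩ := Submodule.mem_span_pair.1 hm
    have := hv.coeff_eq_of_three (a := c) (b := d) (c := 0) (a' := 0) (b' := 0) (c' := 1)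
      (by simpa using hc)
    exact zero_ne_one this.2.2
  rw [Fintype.linearIndependent_iff]
  intro g hg
  rw [Fin.sum_univ_three] at hg
  have g2 : g 2 = 0 := by
    by_contra hne
    refine h2 (Submodule.mem_span_pair.2 ⟨-(g 2)⁻¹ * g 0, -(g 2)⁻¹ * g 1, ?_⟩)
    have : (g 2)⁻¹ • (g 0 • w 0 + g 1 • w 1 + g 2 • w 2) = 0 := by rw [hg, smul_zero]
    rw [smul_add, smul_smul (g 2)⁻¹ (g 2), inv_mul_cancel₀ hne] at this
    linear_combination (norm := module) -this
  rw [g2, zero_smul, add_zero] at hg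
  have g1 : g 1 = 0 := by
    by_contra hne
    refine h01 (Submodule.mem_span_singleton.2 ⟨-(g 1)⁻¹ * g 0, ?_⟩)
    have : (g 1)⁻¹ • (g 0 • w 0 + g 1 • w 1) = 0 := by rw [hg, smul_zero]
    rw [smul_add, smul_smul (g 1)⁻¹ (g 1), inv_mul_cancel₀ hne] at this
    linear_combination (norm := module) -this
  rw [g1, zero_smul, add_zero] at hg
  have g0 : g 0 = 0 := (smul_eq_zero.1 hg).resolve_right (hR.right_ne_zero (h 0))
  intro i
  fin_cases i <;> assumption

/-- The point `(1 : s : t)` is where the line through `(1 : s : 0)` and `(0 : 0 : 1)` meets the line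
through `(1 : 0 : t)` and `(0 : 1 : 0)`; the images meet likewise. -/
theorem add_smul_add_smul (hR : IsCollineation K R) {v : Fin 3 → V} {w : Fin 3 → W}
    (hv : LinearIndependent K v) (h : ∀ i, R (v i) (w i)) {s t s' t' : K}
    (hs : R (v 0 + s • v 1) (w 0 + s' • w 1)) (ht : R (v 0 + t • v 2) (w 0 + t' • w 2)) :
    R (v 0 + s • v 1 + t • v 2) (w 0 + s' • w 1 + t' • w 2) := by
  have hw := hR.linearIndependent hv h
  have hne : v 0 + s • v 1 + t • v 2 ≠ 0 := fun h0 => by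
    have := hv.coeff_eq_of_three (a := 1) (b := s) (c := t) (a' := 0) (b' := 0) (c' := 0)
      (by simpa using h0)
    exact one_ne_zero this.1
  obtain ⟨z, hz⟩ := hR.exists_right hne
  obtain ⟨a, b, hab⟩ := Submodule.mem_span_pair.1 ((hR.mem_span_iff hs (h 2) hz).2
    (Submodule.mem_span_pair.2 ⟨1, t, by rw [one_smul]⟩))
  obtain ⟨c, d, hcd⟩ := Submodule.mem_span_pair.1 ((hR.mem_span_iff ht (h 1) hz).2
    (Submodule.mem_span_pair.2 ⟨1, s, by rw [one_smul]; abel⟩))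
  obtain ⟨h1, h2, h3⟩ := hw.coeff_eq_of_three (a := a) (b := a * s') (c := b) (a' := c) (b' := d)
    (c' := c * t') (by linear_combination (norm := module) hab - hcd)
  have hz' : z = a • (w 0 + s' • w 1 + t' • w 2) := by
    rw [← hab, h3, ← h1, mul_smul, smul_add, smul_add, smul_add]
  have ha : a ≠ 0 := by
    rintro rfl
    exact hR.right_ne_zero hz (by rw [hz', zero_smul])
  have := hR.smul hz one_ne_zero (inv_ne_zero ha)
  rwa [one_smul, hz', smul_smul, inv_mul_cancel₀ ha, one_smul] at this

/-- The point `(0 : s : t)` is where the line through `(1 : s : t)` and `(1 : 0 : 0)` meets the line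
at infinity. -/
theorem smul_add_smul (hR : IsCollineation K R) {v : Fin 3 → V} {w : Fin 3 → W}
    (hv : LinearIndependent K v) (h : ∀ i, R (v i) (w i)) {s t s' t' : K}
    (hs : R (v 0 + s • v 1) (w 0 + s' • w 1)) (ht : R (v 0 + t • v 2) (w 0 + t' • w 2))
    (hne : s • v 1 + t • v 2 ≠ 0) :
    R (s • v 1 + t • v 2) (s' • w 1 + t' • w 2) := by
  have hw := hR.linearIndependent hv h
  have hst := hR.add_smul_add_smul hv h hs ht
  obtain ⟨z, hz⟩ := hR.exists_right hne
  obtain ⟨a, b, hab⟩ := Submodule.mem_span_pair.1 ((hR.mem_span_iff (h 1) (h 2) hz).2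
    (Submodule.mem_span_pair.2 ⟨s, t, rfl⟩))
  obtain ⟨c, d, hcd⟩ := Submodule.mem_span_pair.1 ((hR.mem_span_iff hst (h 0) hz).2
    (Submodule.mem_span_pair.2 ⟨1, -1, by rw [one_smul, neg_one_smul]; abel⟩))
  obtain ⟨h1, h2, h3⟩ := hw.coeff_eq_of_three (a := 0) (b := a) (c := b) (a' := c + d)
    (b' := c * s') (c' := c * t') (by linear_combination (norm := module) hab - hcd)
  have hz' : z = c • (s' • w 1 + t' • w 2) := by
    rw [← hab, h2, h3, mul_smul, mul_smul, smul_add]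
  have hc : c ≠ 0 := by
    rintro rfl
    exact hR.right_ne_zero hz (by rw [hz', zero_smul])
  have := hR.smul hz one_ne_zero (inv_ne_zero hc)
  rwa [one_smul, hz', smul_smul, inv_mul_cancel₀ hc, one_smul] at this

/-- A frame `v` and its image can be normalised such that the unit points correspond. -/
theorem exists_frame (hR : IsCollineation K R) {v : Fin 3 → V} (hv : LinearIndependent K v) :
    ∃ w : Fin 3 → W, (∀ i, R (v i) (w i)) ∧ R (v 0 + v 1) (w 0 + w 1) ∧
      R (v 0 + v 2) (w 0 + w 2) := by
  obtain ⟨w0, h0⟩ := hR.exists_right (hv.ne_zero 0)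
  have key : ∀ i : Fin 3, i ≠ 0 → ∃ w, R (v i) w ∧ R (v 0 + v i) (w0 + w) := by
    intro i hi
    obtain ⟨w, h⟩ := hR.exists_right (hv.ne_zero i)
    have h2 : LinearIndependent K ![v 0, v i] := by
      have := hv.comp ![0, i] (by
        intro a b hab
        fin_cases a <;> fin_cases b <;> simp_all [eq_comm])
      convert this using 1
      ext j; fin_cases j <;> rfl
    obtain ⟨s, hs⟩ := hR.exists_add_smul h0 h h2 1
    have hs0 : s ≠ 0 := by
      rintro rfl
      rw [zero_smul, add_zero, one_smul] at hs
      have := (hR.mem_span_iff h0 h0 hs).1 (Submodule.mem_span_pair.2 ⟨1, 0, by simp⟩)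
      obtain ⟨c, d, hcd⟩ := Submodule.mem_span_pair.1 this
      have := LinearIndependent.pair_iff.1 h2 (1 - c - d) 1
        (by linear_combination (norm := module) -hcd)
      exact one_ne_zero this.2
    refine ⟨s • w, ?_, by simpa using hs⟩
    simpa using hR.smul h one_ne_zero hs0
  obtain ⟨w1, h1, h01⟩ := key 1 (by decide)
  obtain ⟨w2, h2, h02⟩ := key 2 (by decide)
  refine ⟨![w0, w1, w2], ?_, h01, h02⟩
  intro i
  fin_cases i
  exacts [h0, h1, h2]

/-- The fundamental theorem of projective geometry for planes. -/
theorem exists_semilinear (hR : IsCollineation K R) (b : Module.Basis (Fin 3) K V) :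
    ∃ (σ : K →+* K) (f : V →ₛₗ[σ] W), ∀ x, x ≠ 0 → R x (f x) := by
  have hv := b.linearIndependent
  obtain ⟨w, h, h01, h02⟩ := hR.exists_frame hv
  have hw := hR.linearIndependent hv h
  have hi : ∀ i : Fin 3, i ≠ 0 → LinearIndependent K ![b 0, b i] := by
    intro i hi
    have := hv.comp ![0, i] (by
      intro a b hab
      fin_cases a <;> fin_cases b <;> simp_all [eq_comm])
    convert this using 1
    ext j; fin_cases j <;> rfl
  choose σ hσ using fun t => hR.exists_add_smul (h 0) (h 1) (hi 1 (by decide)) t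
  choose τ hτ using fun t => hR.exists_add_smul (h 0) (h 2) (hi 2 (by decide)) t
  have uσ : ∀ {t s}, R (b 0 + t • b 1) (w 0 + s • w 1) → s = σ t := by
    intro t s hs
    obtain ⟨c, -, hc⟩ := hR.eq_smul hs (hσ t)
    have := hw.coeff_eq_of_three (a := 1) (b := σ t) (c := 0) (a' := c) (b' := c * s) (c' := 0)
      (by linear_combination (norm := module) hc)
    rw [this.2.1, ← this.1, one_mul]
  have uτ : ∀ {t s}, R (b 0 + t • b 2) (w 0 + s • w 2) → s = τ t := by
    intro t s hs
    obtain ⟨c, -, hc⟩ := hR.eq_smul hs (hτ t)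
    have := hw.coeff_eq_of_three (a := 1) (b := 0) (c := τ t) (a' := c) (b' := 0) (c' := c * s)
      (by linear_combination (norm := module) hc)
    rw [this.2.2, ← this.1, one_mul]
  have σ0 : σ 0 = 0 := (uσ (by simpa using h 0)).symm
  have τ0 : τ 0 = 0 := (uτ (by simpa using h 0)).symm
  have σ1 : σ 1 = 1 := (uσ (by simpa using h01)).symm
  have τ1 : τ 1 = 1 := (uτ (by simpa using h02)).symm
  have inf : ∀ s t, s ≠ 0 ∨ t ≠ 0 → R (s • b 1 + t • b 2) (σ s • w 1 + τ t • w 2) := by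
    intro s t hst
    refine hR.smul_add_smul hv h (hσ s) (hτ t) fun h0 => ?_
    have := hv.coeff_eq_of_three (a := 0) (b := s) (c := t) (a' := 0) (b' := 0) (c' := 0)
      (by linear_combination (norm := module) h0)
    tauto
  -- `(0 : t : t)` and `(0 : 1 : 1)` are the same point.
  have στ : ∀ t, τ t = σ t := by
    intro t
    rcases eq_or_ne t 0 with rfl | ht
    · rw [σ0, τ0]
    have h11 := hR.smul (inf 1 1 (Or.inl one_ne_zero)) ht one_ne_zero
    rw [σ1, τ1, smul_add, smul_smul, smul_smul, mul_one] at h11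
    obtain ⟨c, -, hc⟩ := hR.eq_smul h11 (inf t t (Or.inl ht))
    have := hw.coeff_eq_of_three (a := 0) (b := σ t) (c := τ t) (a' := 0) (b' := c) (c' := c)
      (by linear_combination (norm := module) hc)
    rw [this.2.1, this.2.2]
  obtain rfl : τ = σ := funext στ
  -- `(1 : s + t : 1)` lies on the line through `(1 : s : 0)` and `(0 : t : 1)`.
  have hadd : ∀ s t, τ (s + t) = τ s + τ t := by
    intro s t
    obtain ⟨a, c, hac⟩ := Submodule.mem_span_pair.1 ((hR.mem_span_iff (hσ s)
      (inf t 1 (Or.inr one_ne_zero))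
      (hR.add_smul_add_smul hv h (hσ (s + t)) (hτ 1))).2
      (Submodule.mem_span_pair.2 ⟨1, 1, by module⟩))
    rw [τ1] at hac
    obtain ⟨e1, e2, e3⟩ := hw.coeff_eq_of_three (a := a) (b := a * τ s + c * τ t) (c := c)
      (a' := 1) (b' := τ (s + t)) (c' := 1) (by linear_combination (norm := module) hac)
    rw [← e2, e1, e3, one_mul, one_mul]
  -- `(0 : s : s * t)` and `(0 : 1 : t)` are the same point.
  have hmul : ∀ s t, τ (s * t) = τ s * τ t := by
    intro s t
    rcases eq_or_ne s 0 with rfl | hs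
    · rw [zero_mul, τ0, zero_mul]
    have h1 := hR.smul (inf 1 t (Or.inl one_ne_zero)) hs one_ne_zero
    rw [smul_add, smul_smul, smul_smul, mul_one, τ1, one_smul, one_smul] at h1
    obtain ⟨c, -, hc⟩ := hR.eq_smul h1 (inf s (s * t) (Or.inl hs))
    have := hw.coeff_eq_of_three (a := 0) (b := τ s) (c := τ (s * t)) (a' := 0) (b' := c)
      (c' := c * τ t) (by linear_combination (norm := module) hc)
    rw [this.2.1, this.2.2]
  let ρ : K →+* K :=
    { toFun := τ, map_one' := τ1, map_mul' := hmul, map_zero' := τ0, map_add' := hadd }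
  let f : V →ₛₗ[ρ] W :=
    { toFun := fun x => τ (b.repr x 0) • w 0 + τ (b.repr x 1) • w 1 + τ (b.repr x 2) • w 2
      map_add' := fun x y => by
        simp only [map_add, Finsupp.add_apply, hadd]
        module
      map_smul' := fun c x => by
        simp only [map_smul, Finsupp.smul_apply, smul_eq_mul, hmul]
        change _ = τ c • _
        module }
  refine ⟨ρ, f, fun x hx => ?_⟩
  have hfx : f x = τ (b.repr x 0) • w 0 + τ (b.repr x 1) • w 1 + τ (b.repr x 2) • w 2 := rfl
  have hsum : x = b.repr x 0 • b 0 + b.repr x 1 • b 1 + b.repr x 2 • b 2 := by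
    rw [← Fin.sum_univ_three (fun i => b.repr x i • b i), b.sum_repr]
  generalize b.repr x 0 = r at hfx hsum
  generalize b.repr x 1 = s at hfx hsum
  generalize b.repr x 2 = t at hfx hsum
  rw [hfx]
  clear_value f
  clear hfx
  subst hsum
  rcases eq_or_ne r 0 with rfl | hr
  · have := inf s t (by
      by_contra! h0
      apply hx
      rw [h0.1, h0.2]
      simp)
    rw [τ0, zero_smul, zero_smul, zero_add, zero_add]
    exact this
  · have hρ : τ r ≠ 0 := (map_ne_zero ρ).2 hr
    have := hR.smul (hR.add_smul_add_smul hv h (hσ (r⁻¹ * s)) (hτ (r⁻¹ * t))) hr hρ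
    convert this using 1
    · rw [smul_add, smul_add, smul_smul, smul_smul, mul_inv_cancel_left₀ hr,
        mul_inv_cancel_left₀ hr]
    · rw [smul_add, smul_add, smul_smul, smul_smul, ← hmul, ← hmul, mul_inv_cancel_left₀ hr,
        mul_inv_cancel_left₀ hr]

end IsCollineation

/-! ### Multiplicative collineations and field endomorphisms -/

theorem IsCollineation.exists_ringHom {K E : Type*} [Field K] [Field E] [Algebra K E]
    (hE : Module.finrank K E = 3) {R : E → E → Prop} (hR : IsCollineation K R)
    (hmul : ∀ {x y x' y'}, R x x' → R y y' → R (x * y) (x' * y')) :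
    ∃ g : E →+* E, ∀ x, x ≠ 0 → R x (g x) := by
  have : FiniteDimensional K E := Module.finite_of_finrank_pos (by omega)
  obtain ⟨σ, f, hf⟩ := hR.exists_semilinear (Module.finBasisOfFinrankEq K E hE)
  have hf0 : ∀ x, x ≠ 0 → f x ≠ 0 := fun x hx => hR.right_ne_zero (hf x hx)
  have hc : ∀ x y, x ≠ 0 → y ≠ 0 → ∃ c : K, f (x * y) = c • (f x * f y) := by
    intro x y hx hy
    obtain ⟨c, -, hc⟩ := hR.eq_smul (hmul (hf x hx) (hf y hy)) (hf _ (mul_ne_zero hx hy))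
    exact ⟨c, hc⟩
  have h1 := hf 1 one_ne_zero
  have hf1 := hf0 1 one_ne_zero
  -- For `x` in `K` this is semilinearity. Otherwise `f x` and `f 1` are independent over `K`, and
  -- expanding `f ((x + 1) * y)` in two ways forces the scalars for `(x, y)` and `(1, y)` to agree;
  -- the latter is the inverse of `f 1`.
  have key : ∀ x y, f (x * y) * f 1 = f x * f y := by
    intro x y
    rcases eq_or_ne y 0 with rfl | hy
    · simp
    by_cases hx : x ∈ Submodule.span K {1}
    · obtain ⟨k, rfl⟩ := Submodule.mem_span_singleton.1 hx
      rw [smul_mul_assoc, one_mul, map_smulₛₗ, map_smulₛₗ, smul_mul_assoc, smul_mul_assoc,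
        mul_comm]
    have hx0 : x ≠ 0 := by
      rintro rfl
      exact hx (zero_mem _)
    have hx1 : x + 1 ≠ 0 := fun h0 => hx (Submodule.mem_span_singleton.2 ⟨-1, by
      rw [neg_one_smul]; exact (eq_neg_of_add_eq_zero_left h0).symm⟩)
    obtain ⟨c₁, e₁⟩ := hc (x + 1) y hx1 hy
    obtain ⟨c₂, e₂⟩ := hc x y hx0 hy
    obtain ⟨c₃, e₃⟩ := hc 1 y one_ne_zero hy
    rw [add_mul, map_add, map_add, e₂, e₃, ← smul_mul_assoc, ← smul_mul_assoc,
      ← smul_mul_assoc, ← add_mul] at e₁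
    have e₄ := mul_right_cancel₀ (hf0 y hy) e₁
    have e₅ : (c₂ - c₁) • f x = (c₁ - c₃) • f 1 := by
      linear_combination (norm := module) e₄
    have h12 : c₂ - c₁ = 0 := by
      by_contra hne
      apply hx
      have := (hR.mem_span_iff h1 h1 (hf x hx0)).1
      rw [Set.pair_eq_singleton, Set.pair_eq_singleton] at this
      refine this (Submodule.mem_span_singleton.2 ⟨(c₂ - c₁)⁻¹ * (c₁ - c₃), ?_⟩)
      rw [mul_smul, ← e₅, smul_smul, inv_mul_cancel₀ hne, one_smul]
    have h13 : c₁ - c₃ = 0 := by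
      rw [h12, zero_smul] at e₅
      exact (smul_eq_zero.1 e₅.symm).resolve_right hf1
    obtain rfl := sub_eq_zero.1 h12
    obtain rfl := sub_eq_zero.1 h13
    rw [one_mul] at e₃
    have e₆ : c₂ • f 1 = 1 := by
      refine mul_right_cancel₀ (hf0 y hy) ?_
      rw [smul_mul_assoc, ← e₃, one_mul]
    calc f (x * y) * f 1 = (f x * f y) * (c₂ • f 1) := by
          rw [e₂, smul_mul_assoc, mul_smul_comm]
      _ = f x * f y := by rw [e₆, mul_one]
  obtain ⟨c, hc0, h11⟩ : ∃ c : K, c ≠ 0 ∧ f 1 = algebraMap K E c := by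
    have h2 := hmul h1 h1
    rw [one_mul] at h2
    obtain ⟨c, hc, hcc⟩ := hR.eq_smul h1 h2
    refine ⟨c, hc, mul_right_cancel₀ hf1 ?_⟩
    rw [hcc, Algebra.smul_def]
  refine ⟨{ toFun := fun x => c⁻¹ • f x, map_one' := ?_, map_mul' := ?_, map_zero' := ?_,
            map_add' := ?_ }, fun x hx => ?_⟩
  · rw [h11, Algebra.algebraMap_eq_smul_one, smul_smul, inv_mul_cancel₀ hc0, one_smul]
  · intro x y
    have := key x y
    rw [h11] at this
    rw [smul_mul_smul_comm, ← this, mul_comm (f _), ← Algebra.smul_def, smul_smul,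
      inv_mul_cancel_right₀ hc0]
  · simp
  · intro x y
    simp
  · have := hR.smul (hf x hx) one_ne_zero (inv_ne_zero hc0)
    rwa [one_smul] at this

/-- Every ring endomorphism fixes the prime field, so the degree over it bounds their number. -/
theorem Field.card_ringHom_le {E : Type*} [Field E] {p m : ℕ} (hp : p.Prime)
    (hE : Nat.card E = p ^ m) (hm : m ≠ 0) : Finite (E →+* E) ∧ Nat.card (E →+* E) ≤ m := by
  have : Fact p.Prime := ⟨hp⟩
  have : Finite E := Nat.finite_of_card_ne_zero (by rw [hE]; exact pow_ne_zero _ hp.ne_zero)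
  have : Fintype E := Fintype.ofFinite E
  have : CharP E p := by
    refine (CharP.charP_iff_prime_eq_zero hp).2 ?_
    have h : ((p ^ m : ℕ) : E) = 0 := by
      rw [← hE, Nat.card_eq_fintype_card]
      exact Nat.cast_card_eq_zero E
    rw [Nat.cast_pow] at h
    exact pow_eq_zero_iff hm |>.1 h
  let _ : Algebra (ZMod p) E := ZMod.algebra E p
  have hfin : Module.finrank (ZMod p) E = m := by
    have := Module.natCard_eq_pow_finrank (K := ZMod p) (V := E)
    rw [hE, Nat.card_zmod] at this
    exact (Nat.pow_right_injective hp.two_le this).symm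
  let e : (E →+* E) → (E →ₐ[ZMod p] E) := fun f =>
    { f with
      commutes' := RingHom.congr_fun (Subsingleton.elim (f.comp (algebraMap (ZMod p) E)) _) }
  have he : Function.Injective e := fun f g h => by
    ext x
    exact DFunLike.congr_fun h x
  have : Finite (E →ₐ[ZMod p] E) := inferInstance
  refine ⟨Finite.of_injective e he, (Nat.card_le_card_of_injective e he).trans ?_⟩
  rw [Nat.card_eq_fintype_card, ← hfin]
  exact AlgHom.card_le

/-- Multiplication by a nonzero element as a linear equivalence. -/
noncomputable def mulLeftEquiv (K : Type*) {E : Type*} [Field K] [Field E] [Algebra K E]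
    {t : E} (ht : t ≠ 0) : E ≃ₗ[K] E where
  __ := LinearMap.mulLeft K t
  invFun x := t⁻¹ * x
  left_inv x := inv_mul_cancel_left₀ ht x
  right_inv x := mul_inv_cancel_left₀ ht x

/-! ### Multiples of a line in a cubic extension -/

section Plane

variable {K E : Type*} [Field K] [Field E] [Algebra K E] {L : Submodule K E}

theorem finrank_comap_mulLeft (L : Submodule K E) {t : E} (ht : t ≠ 0) :
    Module.finrank K (L.comap (LinearMap.mulLeft K t)) = Module.finrank K L :=
  (((mulLeftEquiv K ht).ofSubmodule' L).finrank_eq :)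

theorem one_le_finrank_inf (hE : Module.finrank K E = 3) {M : Submodule K E}
    (hL : Module.finrank K L = 2) (hM : Module.finrank K M = 2) :
    1 ≤ Module.finrank K (L ⊓ M : Submodule K E) := by
  have : FiniteDimensional K E := Module.finite_of_finrank_pos (by omega)
  have h1 := Submodule.finrank_sup_add_finrank_inf_eq L M
  have h2 := Submodule.finrank_le (L ⊔ M)
  omega

/-- The lines `x⁻¹L` and `y⁻¹L` meet. With the next lemma, this makes every line a multiple `t⁻¹L`
of `L`. -/
theorem exists_mul_mem (hE : Module.finrank K E = 3) (hL : Module.finrank K L = 2) {x y : E}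
    (hx : x ≠ 0) (hy : y ≠ 0) : ∃ t, t ≠ 0 ∧ x * t ∈ L ∧ y * t ∈ L := by
  have : FiniteDimensional K E := Module.finite_of_finrank_pos (by omega)
  have h := one_le_finrank_inf hE ((finrank_comap_mulLeft L hx).trans hL)
    ((finrank_comap_mulLeft L hy).trans hL)
  obtain ⟨t, ht, ht0⟩ := Submodule.exists_mem_ne_zero_of_ne_bot
    ((Submodule.one_le_finrank_iff).1 h)
  exact ⟨t, ht0, ht.1, ht.2⟩

theorem mem_span_pair_iff_mul_mem (hE : Module.finrank K E = 3) (hL : Module.finrank K L = 2)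
    {x y t : E} (hxy : LinearIndependent K ![x, y]) (ht : t ≠ 0) (hx : x * t ∈ L)
    (hy : y * t ∈ L) (z : E) : z ∈ Submodule.span K {x, y} ↔ z * t ∈ L := by
  have : FiniteDimensional K E := Module.finite_of_finrank_pos (by omega)
  have h : Submodule.span K {x, y} = L.comap (LinearMap.mulLeft K t) := by
    refine Submodule.eq_of_le_of_finrank_eq ?_ ?_
    · rw [Submodule.span_le]
      rintro _ (rfl | rfl)
      · simpa [mul_comm] using hx
      · simpa [mul_comm] using hy
    · rw [finrank_comap_mulLeft L ht, hL, ← Matrix.range_cons_cons_empty (u := ![]),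
        finrank_span_eq_card hxy, Fintype.card_fin]
  rw [h, Submodule.mem_comap, LinearMap.mulLeft_apply, mul_comm]

/-- Multiplication by an element outside `K` moves every line. -/
theorem comap_mulLeft_ne (hE : Module.finrank K E = 3) (hL : Module.finrank K L = 2) {w : E}
    (hw : ∀ c : K, w ≠ algebraMap K E c) : L.comap (LinearMap.mulLeft K w) ≠ L := by
  have : FiniteDimensional K E := Module.finite_of_finrank_pos (by omega)
  intro h
  have : IsSimpleOrder (Subalgebra K E) :=
    Subalgebra.isSimpleOrder_of_finrank_prime K E (by rw [hE]; exact Nat.prime_three)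
  -- The multipliers of `L` into itself form an algebra between `K` and `E`; as the degree `3` is
  -- prime, it is one of the two, and `E` would force `L = E`.
  let S : Subalgebra K E :=
    { carrier := {x | ∀ y ∈ L, x * y ∈ L}
      mul_mem' := fun {a b} ha hb y hy => by
        rw [mul_assoc]
        exact ha _ (hb _ hy)
      add_mem' := fun {a b} ha hb y hy => by
        rw [add_mul]
        exact add_mem (ha _ hy) (hb _ hy)
      algebraMap_mem' := fun c y hy => by
        rw [← Algebra.smul_def]
        exact L.smul_mem c hy }
  have hwS : w ∈ S := fun y hy => by
    rw [← h] at hy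
    exact hy
  rcases eq_bot_or_eq_top S with hS | hS
  · rw [hS] at hwS
    obtain ⟨c, hc⟩ := Algebra.mem_bot.1 hwS
    exact hw c hc.symm
  · obtain ⟨y, hy, hy0⟩ := Submodule.exists_mem_ne_zero_of_ne_bot
      (Submodule.one_le_finrank_iff.1 (by omega : 1 ≤ Module.finrank K L))
    have hLt : L = ⊤ := by
      rw [eq_top_iff]
      intro z _
      have : z * y⁻¹ ∈ S := by rw [hS]; exact Algebra.mem_top
      have := this y hy
      rwa [inv_mul_cancel_right₀ hy0] at this
    rw [hLt, finrank_top] at hL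
    omega

theorem exists_inf_comap_mulLeft (hE : Module.finrank K E = 3) (hL : Module.finrank K L = 2)
    {w : E} (hw : ∀ c : K, w ≠ algebraMap K E c) :
    ∃ x, x ≠ 0 ∧ ∀ y, (y ∈ L ∧ w * y ∈ L) ↔ y ∈ Submodule.span K {x} := by
  have : FiniteDimensional K E := Module.finite_of_finrank_pos (by omega)
  have hw0 : w ≠ 0 := by simpa using hw 0
  have hM := (finrank_comap_mulLeft L hw0).trans hL
  have h1 := one_le_finrank_inf hE hL hM
  have h2 : Module.finrank K (L ⊓ L.comap (LinearMap.mulLeft K w) : Submodule K E) < 2 := by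
    by_contra! h
    have e1 := Submodule.eq_of_le_of_finrank_le (inf_le_left : L ⊓ L.comap
      (LinearMap.mulLeft K w) ≤ _) (by omega)
    have e2 := Submodule.eq_of_le_of_finrank_le (inf_le_right : L ⊓ L.comap
      (LinearMap.mulLeft K w) ≤ _) (by omega)
    exact comap_mulLeft_ne hE hL hw (e2.symm.trans e1)
  obtain ⟨x, hx, hx0⟩ := Submodule.exists_mem_ne_zero_of_ne_bot
    (Submodule.one_le_finrank_iff.1 h1)
  refine ⟨x, hx0, fun y => ?_⟩
  have hspan : Submodule.span K {x} = L ⊓ L.comap (LinearMap.mulLeft K w) := by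
    refine Submodule.eq_of_le_of_finrank_le ?_ ?_
    · rwa [Submodule.span_singleton_le_iff_mem]
    · rw [finrank_span_singleton hx0]
      omega
  rw [hspan]
  rfl

end Plane

/-! ### Discrete logarithms, difference sets and multipliers -/

/-- A discrete logarithm of `E` modulo the nonzero elements of `K`. -/
structure IsDiscreteLog (K : Type*) {E M : Type*} [Field K] [Field E] [Algebra K E] [AddGroup M]
    (lam : E → M) : Prop where
  map_mul : ∀ {x y}, x ≠ 0 → y ≠ 0 → lam (x * y) = lam x + lam y
  exists_eq : ∀ m, ∃ x, x ≠ 0 ∧ lam x = m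
  eq_iff : ∀ {x y}, x ≠ 0 → y ≠ 0 → (lam x = lam y ↔ ∃ c : K, c ≠ 0 ∧ y = c • x)

namespace IsDiscreteLog

variable {K E : Type*} [Field K] [Field E] [Algebra K E]

theorem eq_iff_mem_span {M : Type*} [AddGroup M] {lam : E → M} (h : IsDiscreteLog K lam) {x y : E}
    (hx : x ≠ 0) (hy : y ≠ 0) : lam x = lam y ↔ y ∈ Submodule.span K {x} := by
  rw [h.eq_iff hx hy, Submodule.mem_span_singleton]
  constructor
  · rintro ⟨c, -, rfl⟩
    exact ⟨c, rfl⟩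
  · rintro ⟨c, rfl⟩
    exact ⟨c, fun hc => hy (by rw [hc, zero_smul]), rfl⟩

theorem map_one {M : Type*} [AddGroup M] {lam : E → M} (h : IsDiscreteLog K lam) :
    lam 1 = 0 := by
  have := h.map_mul one_ne_zero one_ne_zero
  rwa [one_mul, left_eq_add] at this

theorem map_smul {M : Type*} [AddGroup M] {lam : E → M} (h : IsDiscreteLog K lam) {x : E} {c : K}
    (hx : x ≠ 0) (hc : c ≠ 0) : lam (c • x) = lam x :=
  ((h.eq_iff hx (smul_ne_zero hc hx)).2 ⟨c, hc, rfl⟩).symm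

/-- Pairs in `D` with difference `lam w` correspond to points `y` with `y` and `w * y` in `L`, and
the distinct lines `L` and `w⁻¹L` meet in one point. -/
theorem isPerfectDifferenceSet {M : Type*} [AddCommGroup M] {lam : E → M}
    (h : IsDiscreteLog K lam) (hE : Module.finrank K E = 3) {L : Submodule K E}
    (hL : Module.finrank K L = 2) {D : Set M} (hD : ∀ x, x ≠ 0 → (lam x ∈ D ↔ x ∈ L)) :
    Ising.IsPerfectDifferenceSet D := by
  intro d hd
  obtain ⟨w, hw0, rfl⟩ := h.exists_eq d
  have hw : ∀ c : K, w ≠ algebraMap K E c := by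
    rintro c rfl
    have hc : c ≠ 0 := by
      rintro rfl
      simp at hw0
    apply hd
    rw [Algebra.algebraMap_eq_smul_one, h.map_smul one_ne_zero hc, h.map_one]
  obtain ⟨x, hx0, hx⟩ := exists_inf_comap_mulLeft hE hL hw
  obtain ⟨hxL, hwx⟩ := (hx x).2 (Submodule.mem_span_singleton_self x)
  refine ⟨(lam x, lam (w * x)), ⟨(hD x hx0).2 hxL, (hD _ (mul_ne_zero hw0 hx0)).2 hwx, ?_⟩, ?_⟩
  · rw [h.map_mul hw0 hx0, add_sub_cancel_right]
  · rintro ⟨d₁, d₂⟩ ⟨h₁, h₂, h₃⟩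
    obtain ⟨y, hy0, rfl⟩ := h.exists_eq d₁
    obtain rfl : d₂ = lam (w * y) := by
      rw [h.map_mul hw0 hy0]
      exact (sub_eq_iff_eq_add.1 h₃.symm)
    have hy := (hx y).1 ⟨(hD y hy0).1 h₁, (hD _ (mul_ne_zero hw0 hy0)).1 h₂⟩
    have := (h.eq_iff_mem_span hx0 hy0).2 hy
    rw [h.map_mul hw0 hy0, h.map_mul hw0 hx0, this]

variable {N : ℕ} {lam : E → ZMod N} {L : Submodule K E} {D : Set (ZMod N)}

/-- A multiplier of the difference set of a line induces a collineation. -/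
theorem isCollineation (h : IsDiscreteLog K lam) (hE : Module.finrank K E = 3)
    (hL : Module.finrank K L = 2) (hD : ∀ x, x ≠ 0 → (lam x ∈ D ↔ x ∈ L))
    (a : (ZMod N)ˣ) (b : ZMod N) (hab : ∀ l, l ∈ D ↔ a * l + b ∈ D) :
    IsCollineation K fun x y : E => x ≠ 0 ∧ y ≠ 0 ∧ lam y = a * lam x where
  left_ne_zero h := h.1
  right_ne_zero h := h.2.1
  exists_right {x} hx := by
    obtain ⟨y, hy, e⟩ := h.exists_eq (a * lam x)
    exact ⟨y, hx, hy, e⟩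
  smul := by
    rintro x y c d ⟨hx, hy, e⟩ hc hd
    exact ⟨smul_ne_zero hc hx, smul_ne_zero hd hy, by rw [h.map_smul hx hc, h.map_smul hy hd, e]⟩
  mem_span_iff := by
    rintro x y z x' y' z' ⟨hx, hx', ex⟩ ⟨hy, hy', ey⟩ ⟨hz, hz', ez⟩
    have hinj : ∀ {m m' : ZMod N}, a * m = a * m' ↔ m = m' := a.isUnit.mul_right_inj
    by_cases hxy : y ∈ Submodule.span K {x}
    · have hxy' : y' ∈ Submodule.span K {x'} := by
        rw [← h.eq_iff_mem_span hx' hy', ex, ey, hinj, h.eq_iff_mem_span hx hy]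
        exact hxy
      have aux : ∀ {u v : E}, v ∈ Submodule.span K {u} →
          Submodule.span K {u, v} = Submodule.span K {u} := by
        intro u v huv
        rw [Set.pair_comm, Submodule.span_insert_eq_span huv]
      rw [aux hxy, aux hxy', ← h.eq_iff_mem_span hx' hz', ex, ez, hinj, h.eq_iff_mem_span hx hz]
    · have hxy' : y' ∉ Submodule.span K {x'} := by
        rwa [← h.eq_iff_mem_span hx' hy', ex, ey, hinj, h.eq_iff_mem_span hx hy]
      have aux : ∀ {u v : E}, u ≠ 0 → v ∉ Submodule.span K {u} → LinearIndependent K ![u, v] := by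
        intro u v hu huv
        rw [LinearIndependent.pair_iff' hu]
        rintro c rfl
        exact huv (Submodule.mem_span_singleton.2 ⟨c, rfl⟩)
      -- The line of `x` and `y` is `t⁻¹L`. The shift `b` is absorbed in `s`, so that the line of
      -- `x'` and `y'` is `s⁻¹L`.
      obtain ⟨t, ht, htx, hty⟩ := exists_mul_mem hE hL hx hy
      obtain ⟨s, hs, es⟩ := h.exists_eq (a * lam t + b)
      have key : ∀ u u' : E, u ≠ 0 → u' ≠ 0 → lam u' = a * lam u → (u' * s ∈ L ↔ u * t ∈ L) := by
        intro u u' hu hu' e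
        rw [← hD _ (mul_ne_zero hu' hs), ← hD _ (mul_ne_zero hu ht), h.map_mul hu' hs,
          h.map_mul hu ht, hab (lam u + lam t), e, es, mul_add, add_assoc]
      rw [mem_span_pair_iff_mul_mem hE hL (aux hx' hxy') hs ((key x x' hx hx' ex).2 htx)
        ((key y y' hy hy' ey).2 hty), key z z' hz hz' ez,
        mem_span_pair_iff_mul_mem hE hL (aux hx hxy) ht htx hty]

theorem exists_ringHom (h : IsDiscreteLog K lam) (hE : Module.finrank K E = 3)
    (hL : Module.finrank K L = 2) (hD : ∀ x, x ≠ 0 → (lam x ∈ D ↔ x ∈ L))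
    (a : (ZMod N)ˣ) (b : ZMod N) (hab : ∀ l, l ∈ D ↔ a * l + b ∈ D) :
    ∃ g : E →+* E, ∀ x, x ≠ 0 → lam (g x) = a * lam x := by
  obtain ⟨g, hg⟩ := (h.isCollineation hE hL hD a b hab).exists_ringHom hE (by
    rintro x y x' y' ⟨hx, hx', ex⟩ ⟨hy, hy', ey⟩
    exact ⟨mul_ne_zero hx hy, mul_ne_zero hx' hy', by
      rw [h.map_mul hx hy, h.map_mul hx' hy', ex, ey, mul_add]⟩)
  exact ⟨g, fun x hx => (hg x hx).2.2⟩

/-- The number of multipliers of the difference set of a line is at most the number of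
field endomorphisms. -/
theorem card_multiplier_le (h : IsDiscreteLog K lam) (hE : Module.finrank K E = 3)
    (hL : Module.finrank K L = 2) (hD : ∀ x, x ≠ 0 → (lam x ∈ D ↔ x ∈ L)) [Finite (E →+* E)] :
    Nat.card {a : (ZMod N)ˣ // ∃ b, ∀ l, l ∈ D ↔ a * l + b ∈ D} ≤ Nat.card (E →+* E) := by
  choose g hg using fun a : {a : (ZMod N)ˣ // ∃ b, ∀ l, l ∈ D ↔ a * l + b ∈ D} =>
    h.exists_ringHom hE hL hD a.1 a.2.choose a.2.choose_spec
  refine Nat.card_le_card_of_injective g fun a a' haa => ?_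
  -- The endomorphism determines `a` through its effect on an element of logarithm `1`.
  obtain ⟨x, hx, e⟩ := h.exists_eq 1
  have h1 := hg a x hx
  rw [haa, hg a' x hx, e, mul_one, mul_one] at h1
  exact Subtype.ext (Units.ext h1.symm)

end IsDiscreteLog

/-! ### Correlations and the count of affine images -/

open scoped Classical in
theorem Ising.coe_configOf {F : Type*} (D : Set F) (l : F) :
    (Ising.configOf D l : ℤ) = 1 - 2 * (if l ∈ D then 1 else 0) := by
  by_cases h : l ∈ D <;> simp [Ising.configOf, h]

open scoped Classical in
theorem Ising.sum_coe_configOf {F : Type*} [Fintype F] (D : Set F) :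
    ∑ l, (Ising.configOf D l : ℤ) =
      Fintype.card F - 2 * ∑ l : F, (if l ∈ D then (1 : ℤ) else 0) := by
  simp only [Ising.coe_configOf, Finset.sum_sub_distrib, ← Finset.mul_sum]
  simp

open scoped Classical in
/-- The correlation of a perfect difference set is constant away from zero. -/
theorem Ising.IsPerfectDifferenceSet.correlation_eq {F : Type*} [AddCommGroup F] [Fintype F]
    {D : Set F} (hD : Ising.IsPerfectDifferenceSet D) {f : F} (hf : f ≠ 0) :
    Ising.correlation (Ising.configOf D) f =
      Fintype.card F - 4 * ∑ l : F, (if l ∈ D then (1 : ℤ) else 0) + 4 := by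
  have hshift : ∑ l : F, (if l + f ∈ D then (1 : ℤ) else 0) =
      ∑ l : F, (if l ∈ D then (1 : ℤ) else 0) :=
    Equiv.sum_comp (Equiv.addRight f) fun l => if l ∈ D then (1 : ℤ) else 0
  -- Perfectness: exactly one `l` has both `l` and `l + f` in `D`.
  have hpair : ∑ l : F, (if l ∈ D then (1 : ℤ) else 0) * (if l + f ∈ D then 1 else 0) = 1 := by
    obtain ⟨⟨d₁, d₂⟩, ⟨h₁, h₂, h₃⟩, huniq⟩ := hD f hf
    rw [Finset.sum_eq_single d₁]
    · have : d₁ + f = d₂ := by rw [h₃]; abel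
      rw [this, if_pos h₁, if_pos h₂, one_mul]
    · intro l _ hl
      by_contra hne
      have hl₁ : l ∈ D := by
        by_contra h
        simp [h] at hne
      have hl₂ : l + f ∈ D := by
        by_contra h
        simp [h] at hne
      exact hl (congrArg Prod.fst (huniq (l, l + f) ⟨hl₁, hl₂, by simp⟩))
    · simp
  have hexp : ∀ l : F, (Ising.configOf D l : ℤ) * (Ising.configOf D (l + f) : ℤ) =
      1 - 2 * (if l ∈ D then 1 else 0) - 2 * (if l + f ∈ D then 1 else 0) +
        4 * ((if l ∈ D then 1 else 0) * (if l + f ∈ D then 1 else 0)) := by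
    intro l
    rw [Ising.coe_configOf, Ising.coe_configOf]
    ring
  rw [Ising.correlation, Finset.sum_congr rfl fun l _ => hexp l, Finset.sum_add_distrib,
    Finset.sum_sub_distrib, Finset.sum_sub_distrib, ← Finset.mul_sum, ← Finset.mul_sum,
    ← Finset.mul_sum, hshift, hpair]
  simp
  ring

/-- If `t = d₂ - d₁` were a nonzero period, `(d₂, d₂ + t)` would be a second pair with difference
`t`. -/
theorem Ising.IsPerfectDifferenceSet.eq_zero_of_add_mem_iff {F : Type*} [AddCommGroup F]
    {D : Set F} (hD : Ising.IsPerfectDifferenceSet D) {t : F} (ht : ∀ l, l ∈ D ↔ l + t ∈ D) :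
    t = 0 := by
  by_contra h0
  obtain ⟨⟨d₁, d₂⟩, ⟨h₁, h₂, h₃⟩, huniq⟩ := hD t h0
  have := congrArg Prod.fst (huniq (d₂, d₂ + t) ⟨h₂, (ht d₂).1 h₂, by simp⟩)
  simp only at this
  apply h0
  rw [h₃, this, sub_self]

theorem Ising.configOf_eq_iff {F : Type*} {D : Set F} {k l : F} :
    Ising.configOf D k = Ising.configOf D l ↔ (k ∈ D ↔ l ∈ D) := by
  by_cases hk : k ∈ D <;> by_cases hl : l ∈ D <;> simp [Ising.configOf, hk, hl]

/-- The image of a configuration under a sign and an affine substitution. -/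
def Ising.affineConfig {N : ℕ} (σ : Ising.Config (ZMod N))
    (x : ℤˣ × (ZMod N)ˣ × ZMod N) : Ising.Config (ZMod N) :=
  fun l => x.1 * σ (x.2.1 * l + x.2.2)

section

variable {N : ℕ} [NeZero N]

/-- The affine substitution as a permutation. -/
def ZMod.affineEquiv (c : (ZMod N)ˣ) (b : ZMod N) : ZMod N ≃ ZMod N :=
  c.mulLeft.trans (Equiv.addRight b)

theorem Ising.correlation_affineConfig (σ : Ising.Config (ZMod N))
    (x : ℤˣ × (ZMod N)ˣ × ZMod N) (f : ZMod N) :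
    Ising.correlation (Ising.affineConfig σ x) f = Ising.correlation σ (x.2.1 * f) := by
  obtain ⟨s, c, b⟩ := x
  rw [Ising.correlation, Ising.correlation, 
    ← (ZMod.affineEquiv c b).sum_comp fun l => (σ l : ℤ) * (σ (l + c * f) : ℤ)]
  refine Finset.sum_congr rfl fun l _ => ?_
  have hs : (s : ℤ) * s = 1 := by rw [← Units.val_mul, Int.units_mul_self, Units.val_one]
  have e : (c : ZMod N) * (l + f) + b = c * l + b + c * f := by ring
  simp only [Ising.affineConfig, ZMod.affineEquiv, Equiv.trans_apply, Units.mulLeft_apply,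
    Equiv.coe_addRight, e, Units.val_mul]
  linear_combination ((σ (c * l + b) : ℤ) * (σ (c * l + b + c * f) : ℤ)) * hs

theorem Ising.sum_affineConfig (σ : Ising.Config (ZMod N)) (x : ℤˣ × (ZMod N)ˣ × ZMod N) :
    ∑ l, (Ising.affineConfig σ x l : ℤ) = x.1 * ∑ l, (σ l : ℤ) := by
  rw [← (ZMod.affineEquiv x.2.1 x.2.2).sum_comp fun l => (σ l : ℤ), Finset.mul_sum]
  exact Finset.sum_congr rfl fun l _ => Units.val_mul _ _

theorem Ising.IsPerfectDifferenceSet.mul_totient_le_stableDegeneracy (hN : Odd N)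
    {D : Set (ZMod N)} (hD : Ising.IsPerfectDifferenceSet D) {m : ℕ}
    (hm : Nat.card {a : (ZMod N)ˣ // ∃ b, ∀ l, l ∈ D ↔ a * l + b ∈ D} ≤ m) :
    2 * (N * N.totient) ≤ m * Ising.stableDegeneracy (Ising.configOf D) := by
  classical
  set σ := Ising.configOf D with hσ
  -- The sum is `N - 2|D|`, which is odd.
  have hsum : ∑ l, (σ l : ℤ) ≠ 0 := by
    rw [hσ, Ising.sum_coe_configOf, ZMod.card]
    obtain ⟨k, rfl⟩ := hN
    push_cast
    omega
  have hcard : (Finset.univ : Finset (ℤˣ × (ZMod N)ˣ × ZMod N)).card = 2 * (N * N.totient) := by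
    rw [Finset.card_univ, Fintype.card_prod, Fintype.card_prod, ZMod.card_units_eq_totient,
      ZMod.card, Fintype.card_units_int, mul_comm N]
  rw [← hcard, Ising.stableDegeneracy_eq_card_fibre, Nat.card_eq_fintype_card,
    Fintype.card_subtype]
  refine (Finset.card_le_mul_card_image (f := Ising.affineConfig σ) _ m ?_).trans
    (Nat.mul_le_mul_left _ (Finset.card_le_card ?_))
  · intro τ hτ
    obtain ⟨⟨s₀, c₀, b₀⟩, -, rfl⟩ := Finset.mem_image.1 hτ
    refine le_trans ?_ hm
    rw [Nat.card_eq_fintype_card, Fintype.card_subtype]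
    have hsign : ∀ x y, Ising.affineConfig σ x = Ising.affineConfig σ y → x.1 = y.1 := by
      intro x y hxy
      have := Ising.sum_affineConfig σ x
      rw [hxy, Ising.sum_affineConfig σ y] at this
      exact Units.ext (mul_right_cancel₀ hsum this).symm
    have hmem : ∀ x y, Ising.affineConfig σ x = Ising.affineConfig σ y →
        ∀ l, (x.2.1 * l + x.2.2 ∈ D ↔ y.2.1 * l + y.2.2 ∈ D) := by
      intro x y hxy l
      have := congrFun hxy l
      rw [Ising.affineConfig, Ising.affineConfig, hsign x y hxy] at this
      exact Ising.configOf_eq_iff.1 (mul_left_cancel this)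
    -- Fixing one triple `(s₀, c₀, b₀)` of the fibre, the quotient `c * c₀⁻¹` is a multiplier; its
    -- shift results from the substitution `l ↦ c₀⁻¹ * (l - b₀)`.
    refine Finset.card_le_card_of_injOn (fun x => x.2.1 * c₀⁻¹) ?_ ?_
    · rintro ⟨s, c, b⟩ hx
      have hx' := (Finset.mem_filter.1 hx).2
      refine Finset.mem_coe.2 (Finset.mem_filter.2 ⟨Finset.mem_univ _,
        b - c * (c₀⁻¹ : (ZMod N)ˣ) * b₀, fun l => ?_⟩)
      have := hmem _ _ hx' ((c₀⁻¹ : (ZMod N)ˣ) * (l - b₀))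
      simp only [Units.mul_inv_cancel_left, sub_add_cancel] at this
      rw [← this]
      apply iff_of_eq
      congr 1
      push_cast
      ring
    · rintro ⟨s, c, b⟩ hx ⟨s', c', b'⟩ hx' hcc
      have hxx := (Finset.mem_filter.1 hx).2.trans (Finset.mem_filter.1 hx').2.symm
      obtain rfl : s = s' := hsign _ _ hxx
      obtain rfl : c = c' := mul_right_cancel hcc
      have hb : b' - b = 0 := hD.eq_zero_of_add_mem_iff fun l => by
        have := hmem _ _ hxx ((c⁻¹ : (ZMod N)ˣ) * (l - b))
        simp only [Units.mul_inv_cancel_left, sub_add_cancel] at this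
        rw [this]
        apply iff_of_eq
        congr 1
        ring
      rw [sub_eq_zero.1 hb]
  · intro τ hτ
    obtain ⟨x, -, rfl⟩ := Finset.mem_image.1 hτ
    refine Finset.mem_filter.2 ⟨Finset.mem_univ _, funext fun f => ?_⟩
    rw [Ising.correlation_affineConfig]
    rcases eq_or_ne f 0 with rfl | hf
    · rw [mul_zero]
    · rw [hD.correlation_eq hf, hD.correlation_eq (by simpa using hf)]

end

/-! ### The Singer group and its discrete logarithm -/

theorem card_units_quotient {K E : Type*} [Field K] [Field E] [Algebra K E] {q : ℕ}
    (hq : 1 < q) (hK : Nat.card K = q) (hE : Module.finrank K E = 3) :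
    Nat.card (Eˣ ⧸ (Units.map (algebraMap K E : K →* E)).range) = q ^ 2 + q + 1 := by
  have : Finite K := Nat.finite_of_card_ne_zero (by omega)
  have : FiniteDimensional K E := Module.finite_of_finrank_pos (by omega)
  have hcE : Nat.card E = q ^ 3 := by rw [Module.natCard_eq_pow_finrank (K := K), hK, hE]
  have h := Subgroup.card_eq_card_quotient_mul_card_subgroup
    (Units.map (algebraMap K E : K →* E)).range
  have hr : Nat.card (Units.map (algebraMap K E : K →* E)).range = q - 1 := by
    rw [← hK, ← Nat.card_units]
    exact (Nat.card_congr (MonoidHom.ofInjective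
      (Units.map_injective (algebraMap K E).injective)).toEquiv).symm
  rw [hr, Nat.card_units, hcE] at h
  refine Nat.eq_of_mul_eq_mul_right (by omega : 0 < q - 1) ?_
  rw [← h]
  obtain ⟨r, rfl⟩ := Nat.exists_eq_add_of_lt hq
  have : 1 ≤ (1 + r + 1) ^ 3 := Nat.one_le_pow _ _ (by omega)
  zify [this, show 1 ≤ 1 + r + 1 by omega]
  ring

/-- A generator of the units modulo the nonzero elements of `K` yields a discrete logarithm. -/
theorem exists_isDiscreteLog {K E : Type*} [Field K] [Field E] [Algebra K E] {N : ℕ} [NeZero N]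
    (hN : Nat.card (Eˣ ⧸ (Units.map (algebraMap K E : K →* E)).range) = N) (u : Eˣ)
    (hu : ∀ x : Eˣ, ∃ (k : ℤ) (c : K), (x : E) = c • ((u ^ k : Eˣ) : E)) :
    ∃ lam : E → ZMod N, IsDiscreteLog K lam ∧
      ∀ x, x ≠ 0 → ∃ c : K, c ≠ 0 ∧ x = c • (u : E) ^ (lam x).val := by
  set H := (Units.map (algebraMap K E : K →* E)).range with hH
  have hrel : ∀ x y : Eˣ, (x : Eˣ ⧸ H) = y ↔ ∃ c : K, c ≠ 0 ∧ (y : E) = c • (x : E) := by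
    intro x y
    rw [QuotientGroup.eq]
    constructor
    · rintro ⟨c, hc⟩
      refine ⟨c, c.ne_zero, ?_⟩
      rw [eq_inv_mul_iff_mul_eq] at hc
      rw [← hc, Algebra.smul_def, mul_comm]
      rfl
    · rintro ⟨c, hc, h⟩
      refine ⟨Units.mk0 c hc, ?_⟩
      rw [eq_inv_mul_iff_mul_eq]
      ext
      rw [h, Algebra.smul_def, mul_comm]
      rfl
  have hgen : ∀ z : Eˣ ⧸ H, z ∈ Subgroup.zpowers (u : Eˣ ⧸ H) := by
    intro z
    obtain ⟨x, rfl⟩ := QuotientGroup.mk_surjective z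
    obtain ⟨k, c, h⟩ := hu x
    refine ⟨k, ?_⟩
    change ((u : Eˣ ⧸ H)) ^ k = _
    rw [← QuotientGroup.mk_zpow, hrel]
    refine ⟨c, ?_, h⟩
    rintro rfl
    exact x.ne_zero (by rw [h, zero_smul])
  have hord : orderOf (u : Eˣ ⧸ H) = N := by
    rw [← hN]
    exact orderOf_eq_card_of_forall_mem_zpowers hgen
  have : Finite (Eˣ ⧸ H) := Nat.finite_of_card_ne_zero (by rw [hN]; exact NeZero.ne N)
  have hmod : ∀ i j : ℕ, (u : Eˣ ⧸ H) ^ i = (u : Eˣ ⧸ H) ^ j ↔ (i : ZMod N) = j := by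
    intro i j
    rw [ZMod.natCast_eq_natCast_iff, ← hord]
    exact pow_eq_pow_iff_modEq (x := (u : Eˣ ⧸ H))
  have hex : ∀ z : Eˣ ⧸ H, ∃ k : ZMod N, (u : Eˣ ⧸ H) ^ k.val = z := by
    intro z
    obtain ⟨k, rfl⟩ := (mem_powers_iff_mem_zpowers.2 (hgen z))
    refine ⟨k, ?_⟩
    change _ = (u : Eˣ ⧸ H) ^ k
    rw [hmod, ZMod.natCast_zmod_val]
  choose lg hlg using hex
  have hinj : Function.Injective lg := fun z w h => by rw [← hlg z, ← hlg w, h]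
  have hpow : ∀ k : ℕ, lg ((u : Eˣ ⧸ H) ^ k) = k := by
    intro k
    have := hlg ((u : Eˣ ⧸ H) ^ k)
    rwa [hmod, ZMod.natCast_zmod_val] at this
  have hmul : ∀ z w, lg (z * w) = lg z + lg w := by
    intro z w
    rw [← hlg z, ← hlg w, ← pow_add, hpow, hpow, hpow, Nat.cast_add]
  classical
  -- The value at `0` is arbitrary, since `IsDiscreteLog` only concerns nonzero elements.
  let lam : E → ZMod N := fun x => if h : x = 0 then 0 else lg (Units.mk0 x h : Eˣ)
  have hlam : ∀ x (h : x ≠ 0), lam x = lg (Units.mk0 x h : Eˣ) := fun x h => dif_neg h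
  refine ⟨lam, ⟨?_, ?_, ?_⟩, ?_⟩
  · intro x y hx hy
    rw [hlam _ (mul_ne_zero hx hy), hlam _ hx, hlam _ hy, Units.mk0_mul, QuotientGroup.mk_mul,
      hmul]
  · intro k
    refine ⟨(u ^ k.val : Eˣ), Units.ne_zero _, ?_⟩
    rw [hlam _ (Units.ne_zero _), Units.mk0_val, QuotientGroup.mk_pow, hpow, ZMod.natCast_zmod_val]
  · intro x y hx hy
    rw [hlam _ hx, hlam _ hy, hinj.eq_iff, hrel, Units.val_mk0, Units.val_mk0]
  · intro x hx
    have := hlg (Units.mk0 x hx : Eˣ)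
    rwa [← hlam x hx, ← QuotientGroup.mk_pow, hrel, Units.val_mk0, Units.val_pow_eq_pow_val] at this

section Singer

variable {K E : Type*} [Field K] [Field E] [Algebra K E]

theorem toPermHom_mk_eq (x : Eˣ) {v : E} (hv : v ≠ 0) :
    MulAction.toPermHom Eˣ (ℙ K E) x (Projectivization.mk K v hv) =
      Projectivization.mk K (x * v) (mul_ne_zero x.ne_zero hv) :=
  rfl

/-- Evaluation at the point of `1` recovers a unit, up to a scalar, from the permutation it induces.
-/
theorem exists_eq_smul_zpow {g : Ising.singerGroup K E}
    (hg : ∀ x : Ising.singerGroup K E, x ∈ Subgroup.zpowers g) {u : Eˣ}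
    (hu : MulAction.toPermHom Eˣ (ℙ K E) u = g.1) (x : Eˣ) :
    ∃ (k : ℤ) (c : K), (x : E) = c • ((u ^ k : Eˣ) : E) := by
  obtain ⟨k, hk⟩ := hg ⟨MulAction.toPermHom Eˣ (ℙ K E) x, x, rfl⟩
  have h : MulAction.toPermHom Eˣ (ℙ K E) (u ^ k) = MulAction.toPermHom Eˣ (ℙ K E) x := by
    rw [map_zpow, hu]
    exact congrArg Subtype.val hk
  have h1 := DFunLike.congr_fun h (Projectivization.mk K 1 one_ne_zero)
  rw [toPermHom_mk_eq, toPermHom_mk_eq, eq_comm, Projectivization.mk_eq_mk_iff'] at h1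
  obtain ⟨c, hc⟩ := h1
  exact ⟨k, c, by rw [mul_one, mul_one] at hc; exact hc.symm⟩

theorem mem_cyclicDifferenceSet_iff {N : ℕ} {g : Ising.singerGroup K E} {u : Eˣ}
    (hu : MulAction.toPermHom Eˣ (ℙ K E) u = g.1) {v : E} (hv : v ≠ 0) {L : Submodule K E}
    (k : ZMod N) : k ∈ Ising.cyclicDifferenceSet N g (Projectivization.mk K v hv) L ↔
      (u : E) ^ k.val * v ∈ L := by
  change ((g ^ k.val).1 _).submodule ≤ L ↔ _
  rw [Subgroup.coe_pow, ← hu, ← map_pow, toPermHom_mk_eq, Projectivization.submodule_mk,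
    Submodule.span_singleton_le_iff_mem, Units.val_pow_eq_pow_val]

end Singer

theorem proposition4p1 (p n q N : ℕ) [NeZero N] (hp : p.Prime) (hn : 0 < n)
    (hq : q = p ^ n) (hN : N = q ^ 2 + q + 1)
    {K E : Type*} [Field K] [Field E] [Algebra K E]
    (hK : Nat.card K = q) (hE : Module.finrank K E = 3)
    (g : Ising.singerGroup K E) (hg : ∀ x : Ising.singerGroup K E, x ∈ Subgroup.zpowers g)
    (A : ℙ K E) (L : Submodule K E) (hL : Module.finrank K L = 2) :
    Ising.IsPerfectDifferenceSet (Ising.cyclicDifferenceSet N g A L) ∧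
      (2 * (N : ℝ) * (Nat.totient N : ℝ)) / (3 * (n : ℝ)) ≤
        (Ising.stableDegeneracy (Ising.configOf (Ising.cyclicDifferenceSet N g A L)) : ℝ) := by
  have hq1 : 1 < q := by rw [hq]; exact Nat.one_lt_pow hn.ne' hp.one_lt
  obtain ⟨u, hu⟩ := g.2
  induction A using Projectivization.ind with
  | h v hv =>
  obtain ⟨lam, hlam, hpow⟩ := exists_isDiscreteLog
    ((card_units_quotient hq1 hK hE).trans hN.symm) u (exists_eq_smul_zpow hg hu)
  -- With `A` spanned by `v`, the condition `u ^ k * v ∈ L` says that `u ^ k` lies on `v⁻¹L`, so the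
  -- difference set is the logarithm of that line.
  have hL' := (finrank_comap_mulLeft L hv).trans hL
  have hD : ∀ x, x ≠ 0 → (lam x ∈ Ising.cyclicDifferenceSet N g (Projectivization.mk K v hv) L ↔
      x ∈ L.comap (LinearMap.mulLeft K v)) := by
    intro x hx
    obtain ⟨c, hc, e⟩ := hpow x hx
    rw [mem_cyclicDifferenceSet_iff hu hv, Submodule.mem_comap, LinearMap.mulLeft_apply]
    nth_rw 2 [e]
    rw [mul_smul_comm, L.smul_mem_iff hc, mul_comm]
  have hperf := hlam.isPerfectDifferenceSet hE hL' hD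
  refine ⟨hperf, ?_⟩
  have hcE : Nat.card E = p ^ (3 * n) := by
    have : FiniteDimensional K E := Module.finite_of_finrank_pos (by omega)
    rw [Module.natCard_eq_pow_finrank (K := K), hK, hE, hq, ← pow_mul, mul_comm]
  obtain ⟨hfin, hcard⟩ := Field.card_ringHom_le hp hcE (by omega)
  have hodd : Odd N := by
    rw [hN]
    have := Nat.even_mul_succ_self q
    rw [show q ^ 2 + q = q * (q + 1) by ring]
    exact this.add_one
  have := hperf.mul_totient_le_stableDegeneracy hodd
    ((hlam.card_multiplier_le hE hL' hD).trans hcard)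
  have hn' : (0 : ℝ) < n := by exact_mod_cast hn
  rw [div_le_iff₀ (by positivity)]
  have : ((2 * (N * N.totient) : ℕ) : ℝ) ≤ ((3 * n * _ : ℕ) : ℝ) := Nat.cast_le.2 this
  push_cast at this
  linarith
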